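/- **Conventions.** Let $X$ be a compact metrizable group with identity $1$, let $d$ be a metric inducing its topology, and let a countable group $\Gamma$ act on $X$ by continuous automorphisms. The action is *expansive* if there is $c>0$ such that for all $x\neq y$ in $X$ some $g\in\Gamma$ has $d(gx,gy)>c$. A pair $(x,y)$ is *asymptotic* if for every $\varepsilon>0$ the set $\{g\in\Gamma : d(gx,gy)>\varepsilon\}$ is finite; it is *off-diagonal* if $x\ne y$. The *homoclinic group* is the set of $x\in X$ such that $(x,1)$ is asymptotic. For a left Følner sequence $(F_n)$ in an amenable $\Gamma$, the *topological entropy* is $\sup_{\delta>0}\limsup_{n}\frac{1}{|F_n|}\log \operatorname{sep}_{\delta,F_n}$, where $\operatorname{sep}_{\delta,F}$ is the maximal cardinality of a set $Y\subset X$ with $\max_{g\in F}d(gx,gy)\ge\delta$ for all distinct $x,y\in Y$. All these notions are asserted below for every compatible metric $d$, and the value of the entropy for every left Følner sequence. For a sequence $(\Gamma_n)_{n\ge1}$ of finite (not necessarily abelian) groups let $\Gamma=\bigoplus_n\Gamma_n$ be the subgroup of $\prod_n\Gamma_n$ of all sequences that are eventually trivial, with $\Gamma_n$ identified with the $n$-th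 summand. Put $f_n=\sum_{g\in\Gamma_n}g\in\mathbb Z\Gamma$, let $J$ be the left ideal of $\mathbb Z\Gamma$ generated by $2$ and all $f_n$, and let $X=\widehat{\mathbb Z\Gamma/J}$ be the Pontryagin dual of the discrete abelian group $\mathbb Z\Gamma/J$, on which $\Gamma$ acts by $(g\chi)(m)=\chi(g^{-1}m)$. **Theorem.** 1. There exist a totally disconnected compact metrizable abelian group $X$ and a countable amenable subgroup $\Gamma\subset\operatorname{Aut}(X)$, isomorphic to $\bigoplus_{\mathbb Z}\mathbb Z/2\mathbb Z$ (in particular abelian), such that the action of $\Gamma$ on $X$ is expansive, has positive topological entropy, and has no off-diagonal asymptotic pairs. Moreover $(X,\Gamma)$ can be taken to be (isomorphic to) the action constructed above for $\Gamma_n=(\mathbb Z/2\mathbb Z)^{a_n}$ with a suitable sequence $(a_n)$ of natural numbers. 2. For every sequence $(\Gamma_n)$ of finite groups, the group $\Gamma=\bigoplus_n\Gamma_n$ is countable and amenable, $X=\widehat{\mathbb Z\Gamma/J}$ is a totally disconnected compact metrizable abelian group, and the action of $\Gamma$ on $X$ is expansive, has topological entropy $\prod_{n=1}^\infty\left(1-|\Gamma_n|^{-1}\right)\cdot\log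 2$ (where the product may be $0$), has trivial homoclinic group, and has no off-diagonal asymptotic pairs. -/

import Mathlib

open Filter Topology MeasureTheory
open scoped ENNReal

universe u

noncomputable section

namespace AlgebraicAction

/-! ### The group of continuous automorphisms of a topological group -/

/-- `Aut(X)`: the continuous automorphisms of the topological group `X` (with continuous inverse),
with composition as multiplication. -/
instance autGroup (X : Type*) [Group X] [TopologicalSpace X] : Group (X ≃ₜ* X) where
  mul f g := g.trans f
  one := ContinuousMulEquiv.refl X
  inv f := f.symm
  mul_assoc _ _ _ := rfl
  one_mul _ := rfl
  mul_one _ := rfl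
  inv_mul_cancel f := by
    ext x
    exact f.symm_apply_apply x

/-! ### Amenability -/

/-- A left Følner sequence of finite subsets of the (discrete) group `Γ`. -/
def IsLeftFolner {Γ : Type*} [Group Γ] (F : ℕ → Finset Γ) : Prop :=
  letI : MeasurableSpace Γ := ⊤
  IsFoelner Γ (Measure.count : Measure Γ) atTop (fun n => (F n : Set Γ))

/-- Amenability of a countable discrete group: there is a left Følner sequence. -/
def IsAmenable (Γ : Type*) [Group Γ] : Prop :=
  ∃ F : ℕ → Finset Γ, IsLeftFolner F

/-! ### Dynamical notions for actions by automorphisms -/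

section Dynamics

variable {X : Type*} [Group X] [TopologicalSpace X] {Γ : Type*} [Group Γ]

/-- `d` is a metric on `X` that induces the given topology of `X`. -/
def IsCompatibleMetric {X : Type*} [t : TopologicalSpace X] (d : X → X → ℝ) : Prop :=
  ∃ m : MetricSpace X, m.toUniformSpace.toTopologicalSpace = t ∧ ∀ x y, m.dist x y = d x y

/-- The action is expansive with respect to `d`. -/
def IsExpansive (d : X → X → ℝ) (α : Γ →* (X ≃ₜ* X)) : Prop :=
  ∃ c : ℝ, 0 < c ∧ ∀ x y : X, x ≠ y → ∃ g : Γ, c < d (α g x) (α g y)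

/-- `(x, y)` is an asymptotic pair: for every `ε > 0` one has `d (g x) (g y) > ε` for at most
finitely many `g`. -/
def IsAsymptoticPair (d : X → X → ℝ) (α : Γ →* (X ≃ₜ* X)) (x y : X) : Prop :=
  ∀ ε : ℝ, 0 < ε → {g : Γ | ε < d (α g x) (α g y)}.Finite

/-- The homoclinic group: all points that are asymptotic to the identity element. -/
def homoclinicGroup (d : X → X → ℝ) (α : Γ →* (X ≃ₜ* X)) : Set X :=
  {x | IsAsymptoticPair d α x 1}

/-- `Y` is `(F, δ)`-separated. -/
def IsSeparatedSet (d : X → X → ℝ) (α : Γ →* (X ≃ₜ* X)) (F : Finset Γ) (δ : ℝ)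
    (Y : Set X) : Prop :=
  ∀ x ∈ Y, ∀ y ∈ Y, x ≠ y → ∃ g ∈ F, δ ≤ d (α g x) (α g y)

/-- The maximal cardinality of an `(F, δ)`-separated set. -/
def sepNum (d : X → X → ℝ) (α : Γ →* (X ≃ₜ* X)) (F : Finset Γ) (δ : ℝ) : ℕ∞ :=
  ⨆ (Y : Finset X) (_ : IsSeparatedSet d α F δ (Y : Set X)), (Y.card : ℕ∞)

/-- The topological entropy, computed along the sequence `F`:
`sup_{δ > 0} limsup_n (1 / |F n|) * log sep_{δ, F n}`. -/
def topEntropyAlong (d : X → X → ℝ) (α : Γ →* (X ≃ₜ* X)) (F : ℕ → Finset Γ) : EReal :=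
  ⨆ (δ : ℝ) (_ : 0 < δ),
    limsup (fun n => ENNReal.log (sepNum d α (F n) δ : ℝ≥0∞) / ((F n).card : EReal)) atTop

/-- The topological entropy of the action of the countable amenable group `Γ` equals `h`,
along whichever left Følner sequence it is computed (by amenability there is one). -/
def HasTopEntropy (d : X → X → ℝ) (α : Γ →* (X ≃ₜ* X)) (h : EReal) : Prop :=
  ∀ F : ℕ → Finset Γ, IsLeftFolner F → topEntropyAlong d α F = h

end Dynamics

/-! ### The dual action of a module over the group ring -/

section Dual

/-- The additive group `M`, written multiplicatively and carrying the discrete topology. -/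
def DiscreteCopy (M : Type*) : Type _ := Multiplicative M

instance (M : Type*) [AddCommGroup M] : CommGroup (DiscreteCopy M) :=
  inferInstanceAs (CommGroup (Multiplicative M))

instance (M : Type*) : TopologicalSpace (DiscreteCopy M) := ⊥

instance (M : Type*) : DiscreteTopology (DiscreteCopy M) := ⟨rfl⟩

/-- The Pontryagin dual of the additive group `M` with the discrete topology. -/
abbrev ModuleDual (M : Type*) [AddCommGroup M] : Type _ :=
  PontryaginDual (DiscreteCopy M)

variable {M : Type*} [AddCommGroup M]

/-- The value `χ m` of a character. -/
def ModuleDual.eval (χ : ModuleDual M) (m : M) : Circle :=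
  χ (show DiscreteCopy M from Multiplicative.ofAdd m)

theorem ModuleDual.ext {χ ψ : ModuleDual M} (h : ∀ m, χ.eval m = ψ.eval m) : χ = ψ :=
  PontryaginDual.ext fun a => h (Multiplicative.toAdd (show Multiplicative M from a))

/-- The continuous endomorphism `χ ↦ χ ∘ f` of the dual given by an endomorphism `f` of `M`. -/
def ModuleDual.map (f : M →+ M) : ModuleDual M →ₜ* ModuleDual M :=
  PontryaginDual.map
    { toMonoidHom := (show DiscreteCopy M →* DiscreteCopy M from AddMonoidHom.toMultiplicative f)
      continuous_toFun := continuous_of_discreteTopology }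

theorem ModuleDual.eval_map (f : M →+ M) (χ : ModuleDual M) (m : M) :
    (ModuleDual.map f χ).eval m = χ.eval (f m) := rfl

variable (Γ : Type*) [Group Γ] [Module (MonoidAlgebra ℤ Γ) M]

/-- Multiplication by the group element `g` on a `ℤΓ`-module. -/
def groupMul (g : Γ) : M →+ M :=
  DistribSMul.toAddMonoidHom M (MonoidAlgebra.of ℤ Γ g)

variable {Γ} in
theorem groupMul_mul (g h : Γ) (m : M) :
    groupMul Γ (g * h) m = groupMul Γ g (groupMul Γ h m) := by
  simp only [groupMul, DistribSMul.toAddMonoidHom_apply, map_mul, mul_smul]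

theorem groupMul_one (m : M) : groupMul Γ (1 : Γ) m = m := by
  simp only [groupMul, DistribSMul.toAddMonoidHom_apply, map_one, one_smul]

variable (M)

/-- The algebraic action of `Γ` on the Pontryagin dual of a left `ℤΓ`-module `M`,
`(g • χ)(m) = χ (g⁻¹ m)`. -/
def dualAction : Γ →* (ModuleDual M ≃ₜ* ModuleDual M) where
  toFun g :=
    { toFun := ModuleDual.map (groupMul Γ g⁻¹)
      invFun := ModuleDual.map (groupMul Γ g)
      left_inv := fun χ => ModuleDual.ext fun m => by
        rw [ModuleDual.eval_map, ModuleDual.eval_map, ← groupMul_mul, inv_mul_cancel, groupMul_one]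
      right_inv := fun χ => ModuleDual.ext fun m => by
        rw [ModuleDual.eval_map, ModuleDual.eval_map, ← groupMul_mul, mul_inv_cancel, groupMul_one]
      map_mul' := map_mul (ModuleDual.map (groupMul Γ g⁻¹))
      continuous_toFun := (ModuleDual.map (groupMul Γ g⁻¹)).continuous_toFun
      continuous_invFun := (ModuleDual.map (groupMul Γ g)).continuous_toFun }
  map_one' := by
    refine ContinuousMulEquiv.ext fun χ => ModuleDual.ext fun m => ?_
    change (ModuleDual.map (groupMul Γ (1 : Γ)⁻¹) χ).eval m = χ.eval m
    rw [ModuleDual.eval_map, inv_one, groupMul_one]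
  map_mul' g h := by
    refine ContinuousMulEquiv.ext fun χ => ModuleDual.ext fun m => ?_
    change (ModuleDual.map (groupMul Γ (g * h)⁻¹) χ).eval m =
      (ModuleDual.map (groupMul Γ g⁻¹) (ModuleDual.map (groupMul Γ h⁻¹) χ)).eval m
    rw [ModuleDual.eval_map, ModuleDual.eval_map, ModuleDual.eval_map, mul_inv_rev, groupMul_mul]

theorem dualAction_eval (g : Γ) (χ : ModuleDual M) (m : M) :
    (dualAction M Γ g χ).eval m = χ.eval (MonoidAlgebra.of ℤ Γ g⁻¹ • m) := rfl

end Dual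

/-! ### The construction -/

section Construction

variable (G : ℕ → Type u) [∀ n, Group (G n)]

/-- The direct sum `⨁ₙ Gₙ` of a sequence of (not necessarily abelian) groups: the subgroup of the
product consisting of the sequences with `gₙ = 1` for all large `n`. -/
def DirectSumGroup : Subgroup (∀ n, G n) where
  carrier := {g | ∃ N, ∀ n, N ≤ n → g n = 1}
  one_mem' := ⟨0, fun _ _ => rfl⟩
  mul_mem' := by
    rintro a b ⟨N, hN⟩ ⟨K, hK⟩
    refine ⟨max N K, fun n hn => ?_⟩
    rw [Pi.mul_apply, hN n (le_trans (le_max_left _ _) hn),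
      hK n (le_trans (le_max_right _ _) hn), one_mul]
  inv_mem' := by
    rintro a ⟨N, hN⟩
    exact ⟨N, fun n hn => by rw [Pi.inv_apply, hN n hn, inv_one]⟩

/-- The embedding of the `n`-th summand. -/
def inclusion (n : ℕ) : G n →* DirectSumGroup G :=
  (MonoidHom.mulSingle G n).codRestrict (DirectSumGroup G) fun h =>
    ⟨n + 1, fun k hk => Pi.mulSingle_eq_of_ne (by omega) h⟩

variable [∀ n, Fintype (G n)]

/-- `fₙ = ∑_{g ∈ Gₙ} g`, an element of the integral group ring of `⨁ₙ Gₙ`. -/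
def blockSum (n : ℕ) : MonoidAlgebra ℤ (DirectSumGroup G) :=
  ∑ h : G n, MonoidAlgebra.of ℤ (DirectSumGroup G) (inclusion G n h)

/-- The left ideal generated by `2` and all `fₙ`. -/
def relationIdeal : Ideal (MonoidAlgebra ℤ (DirectSumGroup G)) :=
  Ideal.span (insert 2 (Set.range (blockSum G)))

/-- The left `ℤΓ`-module `ℤΓ / ⟨2, fₙ⟩`, where `Γ = ⨁ₙ Gₙ`. -/
abbrev QuotientModule : Type u :=
  MonoidAlgebra ℤ (DirectSumGroup G) ⧸ relationIdeal G

/-- The compact abelian group dual to `ℤΓ / ⟨2, fₙ⟩`. -/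
abbrev DualGroup : Type u := ModuleDual (QuotientModule G)

/-- The algebraic action of `Γ = ⨁ₙ Gₙ` on the dual of `ℤΓ / ⟨2, fₙ⟩`. -/
abbrev constructionAction : DirectSumGroup G →* (DualGroup G ≃ₜ* DualGroup G) :=
  dualAction (QuotientModule G) (DirectSumGroup G)

end Construction

end AlgebraicAction

end

/-!
A character `x` of `ℤΓ / ⟨2, fₙ⟩` takes the values `±1` on `Γ`, so it is a function `coord x` from
`Γ` to `𝔽₂`. The functions that occur are exactly those whose sum over every coset `a Γₙ` vanishes
(`lineSumsVanish_coord`, `exists_coord_eq`), and `Γ` acts on them by translation. Everything is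
read off from this subshift.

*Expansiveness and asymptotic pairs.* Points with different coordinates at `1` are uniformly far
apart, which gives expansiveness. The difference of the two points of an asymptotic pair has finite
support, and it vanishes because a line in a direction beyond the support meets the support at most
once (`LineSumsVanish.eq_zero_of_finite_support`).

*Entropy.* Let `H = ∏_{n < N} Γₙ`. The points of a coset of `H` whose first `N` entries are all
nontrivial form a proportion `∏_{n < N} (1 - |Γₙ|⁻¹)` of the coset, and the values there determine
all others on the coset (`LineSumsVanish.eq_zero_of_nontrivialBelow`). A set separated along `F` at
a given scale injects into the patterns on `F⁻¹ H` for large `N`, and `|F⁻¹ H| = |H F|` is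
asymptotically `|F|` along a left Følner sequence; this is the upper bound (`sepNum_le`).
Conversely, if no `Γₙ` is trivial, the values at these points can be prescribed by adding up
indicators of cubes `∏ₙ {1, bₙ}` (`exists_lineSumsVanish_eq`). By averaging, some translate of
`F⁻¹` by an element of `H` contains at least the expected number of them, so that there are at least
`2 ^ (p |F|)` separated points, where `p` is the infinite product (`le_sepNum`). If some `Γₙ` is
trivial, then `p = 0` and there is nothing to prove for the lower bound.

*The abelian example.* For `Γₙ = (ℤ/2)^(n+2)` the product is at least `1/2` and the action is
faithful, so `Γ` may be viewed as a group of automorphisms of `X`. It is a vector space over `𝔽₂` of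
countably infinite dimension, as is `⨁_ℤ ℤ/2ℤ`.
-/

namespace AlgebraicAction

/-! ### Coordinates of the dual group -/

namespace ModuleDual

variable {M : Type*} [AddCommGroup M]

theorem eval_add (χ : ModuleDual M) (m n : M) : χ.eval (m + n) = χ.eval m * χ.eval n :=
  _root_.map_mul χ _ _

theorem eval_zero (χ : ModuleDual M) : χ.eval 0 = 1 :=
  _root_.map_one χ

/-- A character of `M` as a homomorphism into the circle, written additively. -/
noncomputable def evalHom (χ : ModuleDual M) : M →+ Additive Circle where
  toFun m := Additive.ofMul (χ.eval m)
  map_zero' := χ.eval_zero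
  map_add' := χ.eval_add

theorem continuous_eval (m : M) : Continuous fun χ : ModuleDual M => χ.eval m :=
  (ContinuousMonoidHom.isInducing_toContinuousMap _ _).continuous.eval_const _

/-- A homomorphism from `M` to the circle, as a point of the dual. -/
noncomputable def ofHom (f : M →+ Additive Circle) : ModuleDual M :=
  (show DiscreteCopy M →ₜ* Circle from
    { toMonoidHom := (show DiscreteCopy M →* Circle from AddMonoidHom.toMultiplicativeLeft f)
      continuous_toFun := continuous_of_discreteTopology })

theorem eval_ofHom (f : M →+ Additive Circle) (m : M) :
    (ofHom f).eval m = (f m).toMul := rfl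

end ModuleDual

variable {G : ℕ → Type u} [∀ n, Group (G n)] [∀ n, Fintype (G n)]

/-- The image of `g` in `ℤΓ / ⟨2, fₙ⟩`. -/
noncomputable def groupElt (g : DirectSumGroup G) : QuotientModule G :=
  Submodule.Quotient.mk (MonoidAlgebra.of ℤ (DirectSumGroup G) g)

open Classical in
/-- The coordinate at `g` of a character `x` of `ℤΓ / ⟨2, fₙ⟩`: as `2` is killed, `x` takes the value
`1` or `-1` at `g`, recorded here additively. -/
noncomputable def coord (x : DualGroup G) (g : DirectSumGroup G) : ZMod 2 :=
  if x.eval (groupElt g) = 1 then 0 else 1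

theorem two_nsmul_quotientModule (m : QuotientModule G) : m + m = 0 := by
  induction m using Submodule.Quotient.induction_on with
  | H r =>
    rw [← Submodule.Quotient.mk_add, Submodule.Quotient.mk_eq_zero, ← mul_two]
    exact Ideal.mul_mem_left _ _ (Ideal.subset_span (Set.mem_insert _ _))

theorem toCircle_one_ne : (ZMod.toCircle (1 : ZMod 2)) ≠ 1 := fun h =>
  one_ne_zero (ZMod.injective_toCircle (h.trans (AddChar.map_zero_eq_one _).symm))

theorem toCircle_one_mul_self : (ZMod.toCircle (1 : ZMod 2)) * ZMod.toCircle (1 : ZMod 2) = 1 := by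
  rw [← AddChar.map_add_eq_mul]
  exact AddChar.map_zero_eq_one _

theorem eq_toCircle_one {c : Circle} (h : c * c = 1) (h1 : c ≠ 1) :
    c = ZMod.toCircle (1 : ZMod 2) := by
  have key : ∀ z : Circle, z * z = 1 → z ≠ 1 → (z : ℂ) = -1 := fun z hz hz1 => by
    have : (z : ℂ) * z = 1 := by rw [← Circle.coe_mul, hz, Circle.coe_one]
    exact (mul_self_eq_one_iff.1 this).resolve_left fun h => hz1 (Circle.ext h)
  exact Circle.ext ((key _ h h1).trans (key _ toCircle_one_mul_self toCircle_one_ne).symm)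

theorem eval_eq_one_or (x : DualGroup G) (m : QuotientModule G) :
    x.eval m = 1 ∨ x.eval m = ZMod.toCircle (1 : ZMod 2) := by
  by_cases h : x.eval m = 1
  · exact .inl h
  · refine .inr (eq_toCircle_one ?_ h)
    rw [← ModuleDual.eval_add, two_nsmul_quotientModule, ModuleDual.eval_zero]

theorem toCircle_coord (x : DualGroup G) (g : DirectSumGroup G) :
    ZMod.toCircle (coord x g) = x.eval (groupElt g) := by
  unfold coord
  split_ifs with h
  · rw [h]
    exact AddChar.map_zero_eq_one _
  · exact ((eval_eq_one_or x _).resolve_left h).symm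

theorem coord_constructionAction (g : DirectSumGroup G) (x : DualGroup G) (a : DirectSumGroup G) :
    coord (constructionAction G g x) a = coord x (g⁻¹ * a) := by
  apply ZMod.injective_toCircle
  rw [toCircle_coord, toCircle_coord, constructionAction, dualAction_eval, groupElt, groupElt,
    ← Submodule.Quotient.mk_smul, map_mul, smul_eq_mul]

theorem coord_injective : Function.Injective (coord : DualGroup G → DirectSumGroup G → ZMod 2) := by
  intro x y h
  have key : x.evalHom.comp (Submodule.mkQ (relationIdeal G)).toAddMonoidHom =
      y.evalHom.comp (Submodule.mkQ (relationIdeal G)).toAddMonoidHom := by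
    refine MonoidAlgebra.addHom_ext' fun g => AddMonoidHom.ext_int ?_
    have := congrArg ZMod.toCircle (congrFun h g)
    rw [toCircle_coord, toCircle_coord] at this
    exact this
  refine ModuleDual.ext fun m => ?_
  induction m using Submodule.Quotient.induction_on with
  | H r => exact DFunLike.congr_fun key r

/-- The functions `Γ → 𝔽₂` whose sum over every coset `a Γₙ` vanishes. -/
def LineSumsVanish (z : DirectSumGroup G → ZMod 2) : Prop :=
  ∀ (n : ℕ) (a : DirectSumGroup G), ∑ h : G n, z (a * inclusion G n h) = 0

theorem lineSumsVanish_coord (x : DualGroup G) : LineSumsVanish (coord x) := by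
  intro n a
  have h0 : (Submodule.mkQ (relationIdeal G))
      (MonoidAlgebra.of ℤ (DirectSumGroup G) a * blockSum G n) = 0 :=
    (Submodule.Quotient.mk_eq_zero _).2
      (Ideal.mul_mem_left _ _ (Ideal.subset_span (Set.mem_insert_of_mem _ ⟨n, rfl⟩)))
  rw [blockSum, Finset.mul_sum, map_sum] at h0
  have h1 := congrArg x.evalHom h0
  rw [map_sum, map_zero] at h1
  apply ZMod.injective_toCircle
  rw [AddChar.map_zero_eq_one]
  change AddChar.toAddMonoidHom ZMod.toCircle (∑ h, coord x (a * inclusion G n h)) = 0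
  rw [map_sum, ← h1]
  refine Finset.sum_congr rfl fun h _ => ?_
  rw [← map_mul]
  exact toCircle_coord x _

/-- Every function with vanishing line sums is the coordinate function of a character. -/
theorem exists_coord_eq {z : DirectSumGroup G → ZMod 2} (hz : LineSumsVanish z) :
    ∃ x : DualGroup G, coord x = z := by
  let φ : MonoidAlgebra ℤ (DirectSumGroup G) →+ ZMod 2 :=
    (Finsupp.liftAddHom fun g => zmultiplesHom (ZMod 2) (z g)).comp
      (MonoidAlgebra.coeffAddEquiv (R := ℤ) (M := DirectSumGroup G)).toAddMonoidHom
  have hφ : ∀ g, φ (MonoidAlgebra.of ℤ (DirectSumGroup G) g) = z g := fun g => by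
    simp [φ, MonoidAlgebra.of]
  have hJ : ∀ r ∈ relationIdeal G, ∀ a, φ (a * r) = 0 := by
    intro r hr
    induction hr using Submodule.span_induction with
    | zero => simp
    | add x y _ _ hx hy => intro a; rw [mul_add, map_add, hx, hy, add_zero]
    | smul b x _ hx => intro a; rw [smul_eq_mul, ← mul_assoc, hx]
    | mem r hr =>
      rcases hr with rfl | ⟨n, rfl⟩
      · intro a
        rw [mul_two, map_add]
        exact CharTwo.add_self_eq_zero _
      · suffices h : φ.comp (AddMonoidHom.mulRight (blockSum G n)) = 0 from
          fun a => DFunLike.congr_fun h a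
        refine MonoidAlgebra.addHom_ext' fun g => AddMonoidHom.ext_int ?_
        change φ (MonoidAlgebra.of ℤ (DirectSumGroup G) g * blockSum G n) = 0
        rw [blockSum, Finset.mul_sum, map_sum, ← hz n g]
        exact Finset.sum_congr rfl fun h _ => by rw [← map_mul, hφ]
  let ψ : QuotientModule G →+ ZMod 2 :=
    QuotientAddGroup.lift (relationIdeal G).toAddSubgroup φ fun r hr => by
      simpa using hJ r hr 1
  refine ⟨ModuleDual.ofHom ((AddChar.toAddMonoidHom ZMod.toCircle).comp ψ), funext fun g => ?_⟩
  apply ZMod.injective_toCircle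
  rw [toCircle_coord, ModuleDual.eval_ofHom, ← hφ g]
  rfl

theorem continuous_coord : Continuous (coord : DualGroup G → DirectSumGroup G → ZMod 2) := by
  refine continuous_pi fun g => ?_
  have hc := ModuleDual.continuous_eval (groupElt (G := G) g)
  refine ⟨fun s _ => ?_⟩
  -- The preimage of any set is a union of the closed sets `{x | x(g) = 1}` and `{x | x(g) = -1}`,
  -- hence so is that of its complement.
  suffices h : ∀ t : Set (ZMod 2), IsClosed ((fun x : DualGroup G => coord x g) ⁻¹' t) from
    isClosed_compl_iff.1 (h sᶜ)
  intro t
  have : (fun x : DualGroup G => coord x g) ⁻¹' t =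
      (fun x : DualGroup G => x.eval (groupElt g)) ⁻¹' (ZMod.toCircle '' t) := by
    ext x
    rw [Set.mem_preimage, Set.mem_preimage, ← toCircle_coord,
      ZMod.injective_toCircle.mem_set_image]
  rw [this]
  exact (Set.Finite.isClosed (Set.toFinite _)).preimage hc

theorem isClosedEmbedding_coord :
    IsClosedEmbedding (coord : DualGroup G → DirectSumGroup G → ZMod 2) :=
  continuous_coord.isClosedEmbedding coord_injective

end AlgebraicAction

namespace AlgebraicAction

/-! ### Functions with vanishing line sums -/

variable {G : ℕ → Type u} [∀ n, Group (G n)]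

theorem inclusion_apply_self (n : ℕ) (h : G n) : (inclusion G n h).1 n = h :=
  Pi.mulSingle_eq_same n h

theorem inclusion_apply_of_ne {n m : ℕ} (hm : m ≠ n) (h : G n) : (inclusion G n h).1 m = 1 :=
  Pi.mulSingle_eq_of_ne hm h

/-- A finite sequence in `∏_{n < N} Γₙ`, continued by `1`. -/
def headEmbedding (N : ℕ) : (∀ i : Fin N, G i) ↪ DirectSumGroup G where
  toFun p := ⟨fun n => if h : n < N then p ⟨n, h⟩ else 1,
    N, fun n hn => dif_neg (not_lt.2 hn)⟩
  inj' p q h := funext fun i => by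
    have := congrFun (congrArg Subtype.val h) i
    simpa using this

theorem headEmbedding_apply_fin (N : ℕ) (p : ∀ i : Fin N, G i) (i : Fin N) :
    (headEmbedding N p).1 i = p i :=
  dif_pos i.2

variable [∀ n, Fintype (G n)]

open Classical in
/-- The finite subgroup `∏_{n < N} Γₙ` of `⨁ₙ Γₙ`, as a finite set. -/
noncomputable def head (G : ℕ → Type u) [∀ n, Group (G n)] [∀ n, Fintype (G n)] (N : ℕ) :
    Finset (DirectSumGroup G) :=
  Finset.univ.map (headEmbedding N)

theorem mem_head {N : ℕ} {g : DirectSumGroup G} : g ∈ head G N ↔ ∀ n, N ≤ n → g.1 n = 1 := by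
  simp only [head, Finset.mem_map, Finset.mem_univ, true_and]
  constructor
  · rintro ⟨p, rfl⟩ n hn
    exact dif_neg (not_lt.2 hn)
  · intro h
    refine ⟨fun i => g.1 i, Subtype.ext (funext fun n => ?_)⟩
    by_cases hn : n < N
    · exact dif_pos hn
    · exact (dif_neg hn).trans (h n (not_lt.1 hn)).symm

theorem one_mem_head (N : ℕ) : (1 : DirectSumGroup G) ∈ head G N :=
  mem_head.2 fun _ _ => rfl

theorem mul_mem_head {N : ℕ} {g h : DirectSumGroup G} (hg : g ∈ head G N) (hh : h ∈ head G N) :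
    g * h ∈ head G N :=
  mem_head.2 fun n hn => by
    change g.1 n * h.1 n = 1
    rw [mem_head.1 hg n hn, mem_head.1 hh n hn, one_mul]

theorem inv_mem_head {N : ℕ} {g : DirectSumGroup G} (hg : g ∈ head G N) : g⁻¹ ∈ head G N :=
  mem_head.2 fun n hn => by
    change (g.1 n)⁻¹ = 1
    rw [mem_head.1 hg n hn, inv_one]

theorem inclusion_mem_head {N n : ℕ} (hn : n < N) (h : G n) : inclusion G n h ∈ head G N :=
  mem_head.2 fun m hm => inclusion_apply_of_ne (by omega) h

theorem head_mono : Monotone (head G) := fun _ _ h _ hg =>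
  mem_head.2 fun n hn => mem_head.1 hg n (h.trans hn)

theorem exists_subset_head (A : Finset (DirectSumGroup G)) : ∃ N, A ⊆ head G N := by
  classical
  induction A using Finset.induction_on with
  | empty => exact ⟨0, by simp⟩
  | insert a s _ ih =>
    obtain ⟨N, hN⟩ := ih
    obtain ⟨K, hK⟩ := a.2
    refine ⟨max N K, Finset.insert_subset (head_mono (le_max_right _ _) (mem_head.2 hK)) ?_⟩
    exact hN.trans (head_mono (le_max_left _ _))

open Classical in
theorem card_filter_head (N : ℕ) (S : ∀ n, Finset (G n)) :
    ((head G N).filter fun h => ∀ n < N, h.1 n ∈ S n).card = ∏ n ∈ Finset.range N, (S n).card := by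
  rw [head, Finset.filter_map, Finset.card_map, ← Fin.prod_univ_eq_prod_range (fun n => (S n).card),
    ← Fintype.card_piFinset]
  congr 1
  ext p
  simp only [Finset.mem_filter, Finset.mem_univ, true_and, Function.comp, Fintype.mem_piFinset]
  refine ⟨fun h i => ?_, fun h n hn => ?_⟩
  · rw [← headEmbedding_apply_fin N p i]
    exact h i i.2
  · exact (headEmbedding_apply_fin N p ⟨n, hn⟩) ▸ h ⟨n, hn⟩

theorem card_head (N : ℕ) : (head G N).card = ∏ n ∈ Finset.range N, Fintype.card (G n) := by
  classical
  simpa using card_filter_head N fun n => (Finset.univ : Finset (G n))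

/-- The elements of `⨁ₙ Γₙ` whose first `N` entries are all nontrivial. They form a set of free
coordinates on each coset of `∏_{n < N} Γₙ` for the functions with vanishing line sums. -/
def nontrivialBelow (G : ℕ → Type u) [∀ n, Group (G n)] (N : ℕ) : Set (DirectSumGroup G) :=
  {g | ∀ n < N, g.1 n ≠ 1}

open Classical in
theorem card_filter_head_ne (N : ℕ) (c : ∀ n, G n) :
    ((head G N).filter fun h => ∀ n < N, h.1 n ≠ c n).card =
      ∏ n ∈ Finset.range N, (Fintype.card (G n) - 1) := by
  have := card_filter_head N fun n => (Finset.univ.erase (c n) : Finset (G n))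
  simpa [Finset.card_erase_of_mem] using this

open Classical in
/-- Double counting: each `a` is moved into the free coordinates by `∏_{n < N} (|Γₙ| - 1)` of the
left translations. -/
theorem sum_card_filter_mul_left (N : ℕ) (A : Finset (DirectSumGroup G)) :
    ∑ h ∈ head G N, (A.filter fun a => h * a ∈ nontrivialBelow G N).card =
      A.card * ∏ n ∈ Finset.range N, (Fintype.card (G n) - 1) := by
  refine (Finset.sum_card_bipartiteAbove_eq_sum_card_bipartiteBelow
    (fun (h a : DirectSumGroup G) => h * a ∈ nontrivialBelow G N)).trans ?_
  rw [← smul_eq_mul]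
  refine Finset.sum_eq_card_nsmul fun a _ => ?_
  rw [← card_filter_head_ne N fun n => (a.1 n)⁻¹]
  refine congrArg Finset.card (Finset.filter_congr fun h _ => ?_)
  refine forall₂_congr fun n _ => not_congr ?_
  exact mul_eq_one_iff_eq_inv

open Classical in
theorem sum_card_filter_mul_right (N : ℕ) (A : Finset (DirectSumGroup G)) :
    ∑ h ∈ head G N, (A.filter fun a => a * h ∈ nontrivialBelow G N).card =
      A.card * ∏ n ∈ Finset.range N, (Fintype.card (G n) - 1) := by
  refine (Finset.sum_card_bipartiteAbove_eq_sum_card_bipartiteBelow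
    (fun (h a : DirectSumGroup G) => a * h ∈ nontrivialBelow G N)).trans ?_
  rw [← smul_eq_mul]
  refine Finset.sum_eq_card_nsmul fun a _ => ?_
  rw [← card_filter_head_ne N fun n => (a.1 n)⁻¹]
  refine congrArg Finset.card (Finset.filter_congr fun h _ => ?_)
  refine forall₂_congr fun n _ => not_congr ?_
  exact mul_eq_one_iff_inv_eq.trans eq_comm

/-- The partial products `∏_{n < N} (1 - |Γₙ|⁻¹)`. -/
noncomputable def density (G : ℕ → Type u) [∀ n, Fintype (G n)] (N : ℕ) : ℝ :=
  ∏ n ∈ Finset.range N, (1 - (Fintype.card (G n) : ℝ)⁻¹)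

theorem density_mul_card_head (N : ℕ) :
    density G N * (head G N).card =
      ((∏ n ∈ Finset.range N, (Fintype.card (G n) - 1) : ℕ) : ℝ) := by
  rw [card_head, density, Nat.cast_prod, Nat.cast_prod, ← Finset.prod_mul_distrib]
  refine Finset.prod_congr rfl fun n _ => ?_
  have h : 1 ≤ Fintype.card (G n) := Fintype.card_pos
  have h' : (Fintype.card (G n) : ℝ) ≠ 0 := by positivity
  rw [Nat.cast_sub h, sub_mul, inv_mul_cancel₀ h', one_mul, Nat.cast_one]

theorem card_head_pos (N : ℕ) : (0 : ℝ) < (head G N).card :=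
  Nat.cast_pos.2 (Finset.card_pos.2 ⟨1, one_mem_head N⟩)

open Classical in
/-- Averaging over left translates: some translate of `A` has at least the average number of
points among the free coordinates. -/
theorem exists_density_mul_card_le (N : ℕ) (A : Finset (DirectSumGroup G)) :
    ∃ h ∈ head G N,
      density G N * A.card ≤ ((A.filter fun a => h * a ∈ nontrivialBelow G N).card : ℝ) := by
  by_contra! hlt
  have h1 := Finset.sum_lt_sum_of_nonempty ⟨1, one_mem_head N⟩ hlt
  rw [← Nat.cast_sum, sum_card_filter_mul_left, Finset.sum_const, nsmul_eq_mul, Nat.cast_mul,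
    ← density_mul_card_head] at h1
  exact h1.ne (by ring)

open Classical in
/-- The proportion of free coordinates in a union of cosets of `∏_{n < N} Γₙ`. -/
theorem card_filter_nontrivialBelow {N : ℕ} {E : Finset (DirectSumGroup G)}
    (hE : ∀ e ∈ E, ∀ h ∈ head G N, e * h ∈ E) :
    ((E.filter fun e => e ∈ nontrivialBelow G N).card : ℝ) = density G N * E.card := by
  have key : ∀ h ∈ head G N, (E.filter fun a => a * h ∈ nontrivialBelow G N).card =
      (E.filter fun e => e ∈ nontrivialBelow G N).card := fun h hh => by
    refine Finset.card_nbij' (· * h) (· * h⁻¹) ?_ ?_ ?_ ?_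
    · intro e he
      simp only [Finset.coe_filter, Set.mem_ofPred_eq] at he ⊢
      exact ⟨hE e he.1 h hh, he.2⟩
    · intro e he
      simp only [Finset.coe_filter, Set.mem_ofPred_eq, inv_mul_cancel_right] at he ⊢
      exact ⟨hE e he.1 _ (inv_mem_head hh), he.2⟩
    · intro e _
      exact mul_inv_cancel_right e h
    · intro e _
      exact inv_mul_cancel_right e h
  have h1 := sum_card_filter_mul_right N E
  rw [Finset.sum_congr rfl key, Finset.sum_const, smul_eq_mul] at h1
  have h2 : ((head G N).card : ℝ) * ((E.filter fun e => e ∈ nontrivialBelow G N).card : ℝ) =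
      (head G N).card * (density G N * E.card) := by
    rw [← Nat.cast_mul, h1, Nat.cast_mul, ← density_mul_card_head]
    ring
  exact mul_left_cancel₀ (card_head_pos N).ne' h2

theorem LineSumsVanish.sub {z w : DirectSumGroup G → ZMod 2} (hz : LineSumsVanish z)
    (hw : LineSumsVanish w) : LineSumsVanish (z - w) := fun n a => by
  simp only [Pi.sub_apply, Finset.sum_sub_distrib, hz n a, hw n a, sub_zero]

theorem LineSumsVanish.sum {ι : Type*} (s : Finset ι) {z : ι → DirectSumGroup G → ZMod 2}
    (hz : ∀ i ∈ s, LineSumsVanish (z i)) : LineSumsVanish (fun g => ∑ i ∈ s, z i g) := fun n a => by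
  rw [Finset.sum_comm]
  exact Finset.sum_eq_zero fun i hi => hz i hi n a

theorem LineSumsVanish.eq_zero_of_line {z : DirectSumGroup G → ZMod 2} (hz : LineSumsVanish z)
    (n : ℕ) (a : DirectSumGroup G) (h : ∀ k : G n, k ≠ 1 → z (a * inclusion G n k) = 0) :
    z a = 0 := by
  have := hz n a
  rwa [Finset.sum_eq_single 1 (fun k _ hk => h k hk) (by simp), map_one, mul_one] at this

/-- A function with vanishing line sums is determined on a union of cosets of `∏_{n < N} Γₙ` by its
values at the points whose first `N` entries are nontrivial: the remaining values are found from
the line sums, one block at a time. -/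
theorem LineSumsVanish.eq_zero_of_nontrivialBelow {z : DirectSumGroup G → ZMod 2}
    (hz : LineSumsVanish z) {N : ℕ} {E : Set (DirectSumGroup G)}
    (hE : ∀ e ∈ E, ∀ h ∈ head G N, e * h ∈ E)
    (h0 : ∀ e ∈ E, e ∈ nontrivialBelow G N → z e = 0) : ∀ e ∈ E, z e = 0 := by
  suffices h : ∀ M ≤ N, ∀ e ∈ E, (∀ n, M ≤ n → n < N → e.1 n ≠ 1) → z e = 0 from
    fun e he => h N le_rfl e he fun n h1 h2 => absurd h2 (not_lt.2 h1)
  intro M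
  induction M with
  | zero => exact fun _ e he h => h0 e he fun n hn => h n (Nat.zero_le n) hn
  | succ M ih =>
    intro hM e he h
    by_cases h1 : e.1 M = 1
    · refine hz.eq_zero_of_line M e fun k hk => ?_
      refine ih (by omega) _ (hE e he _ (inclusion_mem_head (by omega) k)) fun n hn hnN => ?_
      change e.1 n * (inclusion G M k).1 n ≠ 1
      rcases hn.eq_or_lt with rfl | hn
      · rwa [h1, one_mul, inclusion_apply_self]
      · rw [inclusion_apply_of_ne (by omega), mul_one]
        exact h n hn hnN
    · refine ih (by omega) e he fun n hn hnN => ?_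
      rcases hn.eq_or_lt with rfl | hn
      · exact h1
      · exact h n hn hnN

/-- A finitely supported function with vanishing line sums is zero: a line in a direction beyond
the support meets the support at most once. -/
theorem LineSumsVanish.eq_zero_of_finite_support {z : DirectSumGroup G → ZMod 2}
    (hz : LineSumsVanish z) (hfin : (Function.support z).Finite) : z = 0 := by
  obtain ⟨N, hN⟩ := exists_subset_head hfin.toFinset
  have hout : ∀ g, g ∉ head G N → z g = 0 := fun g hg => by
    by_contra h
    exact hg (hN (hfin.mem_toFinset.2 h))
  funext a
  by_cases ha : a ∈ head G N
  · refine hz.eq_zero_of_line N a fun k hk => hout _ fun hmem => hk ?_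
    have h1 := mem_head.1 hmem N le_rfl
    change a.1 N * (inclusion G N k).1 N = 1 at h1
    rwa [mem_head.1 ha N le_rfl, one_mul, inclusion_apply_self] at h1
  · exact hout a ha

open Classical in
/-- The indicator function of the cube of all `g` with `gₙ ∈ {1, bₙ}` for every `n`. -/
noncomputable def cubeIndicator (b : ∀ n, G n) (g : DirectSumGroup G) : ZMod 2 :=
  if ∀ n, g.1 n = 1 ∨ g.1 n = b n then 1 else 0

/-- A line meets the cube in either `0` or `2` points. -/
theorem lineSumsVanish_cubeIndicator {b : ∀ n, G n} (hb : ∀ n, b n ≠ 1) :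
    LineSumsVanish (cubeIndicator b) := by
  classical
  intro n a
  have h1 : ∀ h : G n, cubeIndicator b (a * inclusion G n h) =
      if (∀ m, m ≠ n → a.1 m = 1 ∨ a.1 m = b m) ∧ (a.1 n * h = 1 ∨ a.1 n * h = b n)
        then 1 else 0 := fun h => by
    refine if_congr ⟨fun H => ⟨fun m hm => ?_, ?_⟩, fun H m => ?_⟩ rfl rfl
    · have := H m
      change a.1 m * (inclusion G n h).1 m = 1 ∨ a.1 m * (inclusion G n h).1 m = b m at this
      rwa [inclusion_apply_of_ne hm, mul_one] at this
    · have := H n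
      change a.1 n * (inclusion G n h).1 n = 1 ∨ a.1 n * (inclusion G n h).1 n = b n at this
      rwa [inclusion_apply_self] at this
    · change a.1 m * (inclusion G n h).1 m = 1 ∨ a.1 m * (inclusion G n h).1 m = b m
      by_cases hm : m = n
      · subst hm
        rw [inclusion_apply_self]
        exact H.2
      · rw [inclusion_apply_of_ne hm, mul_one]
        exact H.1 m hm
  rw [Finset.sum_congr rfl fun h _ => h1 h]
  by_cases hP : ∀ m, m ≠ n → a.1 m = 1 ∨ a.1 m = b m
  · rw [Finset.sum_congr rfl fun h _ => if_congr (and_iff_right hP) rfl rfl]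
    refine (Fintype.sum_equiv (Equiv.mulLeft (a.1 n)) _
      (fun k => if k = 1 ∨ k = b n then (1 : ZMod 2) else 0) fun h => rfl).trans ?_
    rw [Finset.sum_boole]
    have : (Finset.univ.filter fun k => k = 1 ∨ k = b n) = {1, b n} := by
      ext k
      simp
    rw [this, Finset.card_pair (hb n).symm]
    rfl
  · simp [hP]

open Classical in
/-- The values at the points of `∏_{n < N} Γₙ` with nontrivial entries can be prescribed. -/
theorem exists_lineSumsVanish_eq [∀ n, Nontrivial (G n)] (N : ℕ) (S : Finset (DirectSumGroup G)) :
    ∃ z : DirectSumGroup G → ZMod 2, LineSumsVanish z ∧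
      ∀ g ∈ head G N, g ∈ nontrivialBelow G N → z g = if g ∈ S then 1 else 0 := by
  choose k hk using fun n => exists_ne (1 : G n)
  let ext : DirectSumGroup G → ∀ n, G n := fun b n => if b.1 n = 1 then k n else b.1 n
  have hext : ∀ b n, ext b n ≠ 1 := fun b n => by
    by_cases h : b.1 n = 1
    · simpa [ext, h] using hk n
    · simp [ext, h]
  let T := S.filter fun b => b ∈ head G N ∧ b ∈ nontrivialBelow G N
  refine ⟨fun g => ∑ b ∈ T, cubeIndicator (ext b) g,
    LineSumsVanish.sum T fun b _ => lineSumsVanish_cubeIndicator (hext b), fun g hg hg' => ?_⟩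
  have key : ∀ b ∈ T, cubeIndicator (ext b) g = if g = b then 1 else 0 := fun b hb => by
    obtain ⟨-, hb, hb'⟩ := Finset.mem_filter.1 hb
    refine if_congr ⟨fun H => Subtype.ext (funext fun n => ?_), ?_⟩ rfl rfl
    · by_cases hn : n < N
      · have := (H n).resolve_left (hg' n hn)
        rwa [show ext b n = b.1 n from if_neg (hb' n hn)] at this
      · rw [mem_head.1 hg n (not_lt.1 hn), mem_head.1 hb n (not_lt.1 hn)]
    · rintro rfl n
      by_cases h : g.1 n = 1
      · exact .inl h
      · exact .inr (if_neg h).symm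
  change ∑ b ∈ T, cubeIndicator (ext b) g = _
  rw [Finset.sum_congr rfl key, Finset.sum_ite_eq]
  exact if_congr (by simp [T, hg, hg']) rfl rfl

end AlgebraicAction

open scoped Pointwise symmDiff

namespace AlgebraicAction

/-! ### Følner sequences -/

section Folner

variable {Γ Γ' : Type*} [Group Γ] [Group Γ']

theorem isLeftFolner_iff [DecidableEq Γ] {F : ℕ → Finset Γ} :
    IsLeftFolner F ↔ (∀ᶠ n in atTop, (F n).Nonempty) ∧ ∀ g : Γ,
      Tendsto (fun n => (((g • F n) ∆ F n).card : ℝ≥0∞) / ((F n).card : ℝ≥0∞)) atTop (𝓝 0) := by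
  let _ : MeasurableSpace Γ := ⊤
  have hc : ∀ s : Finset Γ, Measure.count (s : Set Γ) = s.card := fun s =>
    Measure.count_apply_finset' trivial
  change IsFoelner Γ (Measure.count : Measure Γ) atTop (fun n => (F n : Set Γ)) ↔ _
  rw [isFoelner_iff]
  simp only [← Finset.coe_smul_finset, ← Finset.coe_symmDiff, hc]
  constructor
  · rintro ⟨-, h, -, h'⟩
    exact ⟨h.mono fun n hn => Finset.card_ne_zero.1 (by exact_mod_cast hn), h'⟩
  · rintro ⟨h, h'⟩
    exact ⟨.of_forall fun _ => trivial,
      h.mono fun n hn => by exact_mod_cast Finset.card_ne_zero.2 hn,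
      .of_forall fun n => ENNReal.natCast_ne_top _, h'⟩

theorem IsLeftFolner.map (φ : Γ ≃* Γ') {F : ℕ → Finset Γ} (hF : IsLeftFolner F) :
    IsLeftFolner fun n => (F n).map φ.toEquiv.toEmbedding := by
  classical
  rw [isLeftFolner_iff] at hF ⊢
  refine ⟨hF.1.mono fun n hn => hn.map, fun g => ?_⟩
  refine (hF.2 (φ.symm g)).congr fun n => ?_
  rw [Finset.card_map, ← Finset.card_map (s := (φ.symm g • F n) ∆ F n) φ.toEquiv.toEmbedding]
  congr 3
  ext x
  obtain ⟨y, rfl⟩ := φ.surjective x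
  have h1 : ∀ (s : Finset Γ) (z : Γ), φ z ∈ s.map φ.toEquiv.toEmbedding ↔ z ∈ s := fun s z =>
    Finset.mem_map' φ.toEquiv.toEmbedding
  rw [h1, Finset.mem_symmDiff, Finset.mem_symmDiff, h1, ← Finset.inv_smul_mem_iff,
    ← Finset.inv_smul_mem_iff, smul_eq_mul, smul_eq_mul,
    show g⁻¹ * φ y = φ ((φ.symm g)⁻¹ * y) by simp, h1]

/-- The thickening `K F` of a Følner set by a fixed finite set `K` has asymptotically at most the
same size. -/
theorem IsLeftFolner.exists_card_mul_le [DecidableEq Γ] {F : ℕ → Finset Γ} (hF : IsLeftFolner F)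
    (K : Finset Γ) : ∃ r : ℕ → ℝ, Tendsto r atTop (𝓝 1) ∧
      ∀ᶠ n in atTop, ((K * F n).card : ℝ) ≤ r n * (F n).card := by
  rw [isLeftFolner_iff] at hF
  refine ⟨fun n => 1 + ∑ k ∈ K, ((((k • F n) ∆ F n).card : ℝ) / (F n).card), ?_, ?_⟩
  · have : Tendsto (fun n => 1 + ∑ k ∈ K, ((((k • F n) ∆ F n).card : ℝ) / (F n).card)) atTop
        (𝓝 (1 + ∑ _k ∈ K, 0)) := by
      refine tendsto_const_nhds.add (tendsto_finsetSum _ fun k _ => ?_)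
      have := (ENNReal.tendsto_toReal ENNReal.zero_ne_top).comp (hF.2 k)
      simpa [Function.comp_def, ENNReal.toReal_div] using this
    simpa using this
  · filter_upwards [hF.1] with n hn
    have hpos : (0 : ℝ) < (F n).card := Nat.cast_pos.2 hn.card_pos
    rw [add_mul, one_mul, Finset.sum_mul]
    simp only [div_mul_cancel₀ _ hpos.ne']
    norm_cast
    have hsub : K * F n ⊆ F n ∪ K.biUnion fun k => (k • F n) ∆ F n := by
      intro x hx
      obtain ⟨k, hk, y, hy, rfl⟩ := Finset.mem_mul.1 hx
      by_cases h : k * y ∈ F n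
      · exact Finset.mem_union_left _ h
      · exact Finset.mem_union_right _ (Finset.mem_biUnion.2 ⟨k, hk,
          Finset.mem_symmDiff.2 (.inl ⟨Finset.smul_mem_smul_finset hy, h⟩)⟩)
    exact (Finset.card_le_card hsub).trans ((Finset.card_union_le _ _).trans
      (Nat.add_le_add_left Finset.card_biUnion_le _))

end Folner

/-! ### Compatible metrics and separated sets -/

section Metric

variable {X : Type*} [TopologicalSpace X] {d : X → X → ℝ}

theorem IsCompatibleMetric.continuous (hd : IsCompatibleMetric d) :
    Continuous fun p : X × X => d p.1 p.2 := by
  obtain ⟨m, rfl, h⟩ := hd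
  simp only [← h]
  exact continuous_dist

theorem IsCompatibleMetric.self (hd : IsCompatibleMetric d) (x : X) : d x x = 0 := by
  obtain ⟨m, -, h⟩ := hd
  rw [← h, dist_self]

theorem IsCompatibleMetric.pos (hd : IsCompatibleMetric d) {x y : X} (hxy : x ≠ y) :
    0 < d x y := by
  obtain ⟨m, -, h⟩ := hd
  rw [← h]
  exact dist_pos.2 hxy

end Metric

section Entropy

variable {X : Type*} [Group X] [TopologicalSpace X] {Γ Γ' : Type*} [Group Γ] [Group Γ']
  {d : X → X → ℝ} {α : Γ →* (X ≃ₜ* X)}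

theorem card_le_sepNum {F : Finset Γ} {δ : ℝ} {Y : Finset X} (hY : IsSeparatedSet d α F δ Y) :
    (Y.card : ℕ∞) ≤ sepNum d α F δ :=
  le_iSup₂ (f := fun (Y : Finset X) (_ : IsSeparatedSet d α F δ (Y : Set X)) => (Y.card : ℕ∞)) Y hY

theorem one_le_sepNum (F : Finset Γ) (δ : ℝ) : 1 ≤ sepNum d α F δ := by
  have h : IsSeparatedSet d α F δ (({1} : Finset X) : Set X) := by
    intro x hx y hy hxy
    simp only [Finset.coe_singleton, Set.mem_singleton_iff] at hx hy
    exact absurd (hx.trans hy.symm) hxy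
  exact_mod_cast card_le_sepNum h

theorem ennrealLog_two_pow (k : ℕ) :
    ENNReal.log (((2 ^ k : ℕ) : ℕ∞) : ℝ≥0∞) = ((k * Real.log 2 : ℝ) : EReal) := by
  rw [ENNReal.log_pos_real (by simp) (by simp)]
  simp

theorem topEntropyAlong_comp (φ : Γ' ≃* Γ) (F : ℕ → Finset Γ') :
    topEntropyAlong d (α.comp φ.toMonoidHom) F =
      topEntropyAlong d α fun n => (F n).map φ.toEquiv.toEmbedding := by
  have h : ∀ n δ, sepNum d (α.comp φ.toMonoidHom) (F n) δ =
      sepNum d α ((F n).map φ.toEquiv.toEmbedding) δ := fun n δ => by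
    have : ∀ Y : Set X, IsSeparatedSet d (α.comp φ.toMonoidHom) (F n) δ Y ↔
        IsSeparatedSet d α ((F n).map φ.toEquiv.toEmbedding) δ Y := fun Y => by
      refine forall₂_congr fun x _ => forall₃_congr fun y _ _ => ?_
      constructor
      · rintro ⟨g, hg, h⟩
        exact ⟨φ g, Finset.mem_map_of_mem _ hg, h⟩
      · rintro ⟨g, hg, h⟩
        obtain ⟨g, hg', rfl⟩ := Finset.mem_map.1 hg
        exact ⟨g, hg', h⟩
    simp only [sepNum, this]
  simp only [topEntropyAlong, h, Finset.card_map]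

theorem HasTopEntropy.comp (φ : Γ' ≃* Γ) {h : EReal} (H : HasTopEntropy d α h) :
    HasTopEntropy d (α.comp φ.toMonoidHom) h := fun F hF => by
  rw [topEntropyAlong_comp]
  exact H _ (hF.map φ)

end Entropy

variable {G : ℕ → Type u} [∀ n, Group (G n)] [∀ n, Fintype (G n)]
  {d : DualGroup G → DualGroup G → ℝ}

/-! ### Dynamics of the constructed action -/

theorem isClosed_coord_eq (g : DirectSumGroup G) :
    IsClosed {p : DualGroup G × DualGroup G | coord p.1 g = coord p.2 g} :=
  isClosed_eq (((continuous_apply g).comp continuous_coord).comp continuous_fst)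
    (((continuous_apply g).comp continuous_coord).comp continuous_snd)

theorem isClosed_coord_ne (g : DirectSumGroup G) :
    IsClosed {p : DualGroup G × DualGroup G | coord p.1 g ≠ coord p.2 g} :=
  (isClosed_discrete {q : ZMod 2 × ZMod 2 | q.1 ≠ q.2}).preimage
    ((((continuous_apply g).comp continuous_coord).comp continuous_fst).prodMk
    (((continuous_apply g).comp continuous_coord).comp continuous_snd))

/-- Points with different coordinates at `1` are uniformly far apart. -/
theorem exists_pos_le_of_coord_ne (hd : IsCompatibleMetric d) :
    ∃ δ : ℝ, 0 < δ ∧ ∀ x y : DualGroup G, coord x 1 ≠ coord y 1 → δ ≤ d x y := by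
  obtain ⟨δ, hδ, h⟩ := (isClosed_coord_ne (G := G) 1).isCompact.exists_forall_le'
    hd.continuous.continuousOn (a := 0) fun p hp => hd.pos fun h => hp (by rw [h])
  exact ⟨δ, hδ, fun x y hxy => h (x, y) hxy⟩

/-- Points that agree on a large finite block of coordinates are close. -/
theorem exists_head_lt (hd : IsCompatibleMetric d) {δ : ℝ} (hδ : 0 < δ) :
    ∃ N₀, ∀ N ≥ N₀, ∀ x y : DualGroup G, (∀ s ∈ head G N, coord x s = coord y s) → d x y < δ := by
  let K : ℕ → Set (DualGroup G × DualGroup G) := fun N =>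
    {p | δ ≤ d p.1 p.2} ∩ ⋂ s ∈ head G N, {p | coord p.1 s = coord p.2 s}
  have hclosed : ∀ N, IsClosed (K N) := fun N =>
    (isClosed_le continuous_const hd.continuous).inter
      (isClosed_biInter fun s _ => isClosed_coord_eq s)
  have hanti : Antitone K := fun M N hMN =>
    Set.inter_subset_inter_right _ (Set.biInter_subset_biInter_left fun s hs => head_mono hMN hs)
  obtain ⟨N₀, hN₀⟩ : ∃ N, K N = ∅ := by
    by_contra! hne
    obtain ⟨p, hp⟩ := IsCompact.nonempty_iInter_of_sequence_nonempty_isCompact_isClosed K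
      (fun N => hanti (Nat.le_succ N)) hne (hclosed 0).isCompact hclosed
    rw [Set.mem_iInter] at hp
    have hp' : p.1 = p.2 := coord_injective (funext fun g => by
      obtain ⟨N, hN⟩ := exists_subset_head {g}
      have := Set.mem_iInter₂.1 (hp N).2 g (hN (Finset.mem_singleton_self g))
      exact this)
    have := (hp 0).1
    change δ ≤ d p.1 p.2 at this
    rw [hp', hd.self] at this
    exact this.not_gt hδ
  refine ⟨N₀, fun N hN x y hxy => lt_of_not_ge fun h => ?_⟩
  have : (x, y) ∈ K N := ⟨h, Set.mem_iInter₂.2 hxy⟩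
  have := hanti hN this
  rw [hN₀] at this
  exact this

theorem isExpansive_constructionAction (hd : IsCompatibleMetric d) :
    IsExpansive d (constructionAction G) := by
  obtain ⟨δ, hδ, h⟩ := exists_pos_le_of_coord_ne hd
  refine ⟨δ / 2, half_pos hδ, fun x y hxy => ?_⟩
  obtain ⟨g, hg⟩ := Function.ne_iff.1 (coord_injective.ne hxy)
  refine ⟨g⁻¹, (half_lt_self hδ).trans_le (h _ _ ?_)⟩
  rwa [coord_constructionAction, coord_constructionAction, inv_inv, mul_one]

theorem eq_of_isAsymptoticPair (hd : IsCompatibleMetric d) {x y : DualGroup G}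
    (hxy : IsAsymptoticPair d (constructionAction G) x y) : x = y := by
  obtain ⟨δ, hδ, h⟩ := exists_pos_le_of_coord_ne hd
  apply coord_injective
  rw [← sub_eq_zero]
  refine ((lineSumsVanish_coord x).sub (lineSumsVanish_coord y)).eq_zero_of_finite_support ?_
  refine ((hxy (δ / 2) (half_pos hδ)).preimage (inv_injective.injOn)).subset fun g hg => ?_
  refine (half_lt_self hδ).trans_le (h _ _ ?_)
  rw [coord_constructionAction, coord_constructionAction, inv_inv, mul_one]
  exact sub_ne_zero.1 hg

theorem homoclinicGroup_eq (hd : IsCompatibleMetric d) :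
    homoclinicGroup d (constructionAction G) = {1} := by
  ext x
  refine ⟨fun hx => eq_of_isAsymptoticPair hd hx, ?_⟩
  rintro rfl ε hε
  convert Set.finite_empty
  ext g
  simpa [hd.self] using hε.le

/-- Upper bound for separated sets: points separated along `F` differ somewhere on `F⁻¹ H` with
`H = ∏_{n < N} Γₙ`, hence at one of its free coordinates. -/
theorem sepNum_le (hd : IsCompatibleMetric d) {δ : ℝ} (hδ : 0 < δ) :
    ∃ N₀, ∀ N ≥ N₀, ∀ F : Finset (DirectSumGroup G), ∃ k : ℕ,
      (k : ℝ) = density G N * ((open Classical in head G N * F).card : ℝ) ∧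
      sepNum d (constructionAction G) F δ ≤ ((2 ^ k : ℕ) : ℕ∞) := by
  classical
  obtain ⟨N₀, hN₀⟩ := exists_head_lt hd hδ
  refine ⟨N₀, fun N hN F => ?_⟩
  have hE : ∀ e ∈ (head G N * F)⁻¹, ∀ h ∈ head G N, e * h ∈ (head G N * F)⁻¹ := by
    intro e he h hh
    rw [Finset.mem_inv'] at he ⊢
    obtain ⟨k, hk, f, hf, hkf⟩ := Finset.mem_mul.1 he
    exact Finset.mem_mul.2 ⟨h⁻¹ * k, mul_mem_head (inv_mem_head hh) hk, f, hf, by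
      rw [mul_assoc, hkf, mul_inv_rev]⟩
  refine ⟨_, (card_filter_nontrivialBelow hE).trans (by rw [Finset.card_inv]), ?_⟩
  set E' := (head G N * F)⁻¹.filter fun e => e ∈ nontrivialBelow G N with hE'
  refine iSup₂_le fun Y hY => Nat.cast_le.2 ?_
  -- Restriction to the free coordinates of `F⁻¹ ∏_{n < N} Γₙ` is injective on `Y`.
  have hinj : Set.InjOn (fun (x : DualGroup G) (e : E') => coord x e) Y := by
    intro x hx y hy hxy
    by_contra hne
    obtain ⟨g, hg, hlt⟩ := hY x hx y hy hne
    refine hlt.not_gt (hN₀ N hN _ _ fun s hs => ?_)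
    rw [coord_constructionAction, coord_constructionAction, ← sub_eq_zero]
    refine ((lineSumsVanish_coord x).sub (lineSumsVanish_coord y)).eq_zero_of_nontrivialBelow
      (E := ((head G N * F)⁻¹ : Finset _)) hE (fun e he he' => ?_) _ ?_
    · exact sub_eq_zero.2 (congrFun hxy ⟨e, Finset.mem_filter.2 ⟨he, he'⟩⟩)
    · rw [Finset.mem_coe, Finset.mem_inv', mul_inv_rev, inv_inv]
      exact Finset.mul_mem_mul (inv_mem_head hs) hg
  have := Finset.card_le_card_of_injOn (t := Finset.univ) _ (fun x _ => Finset.mem_univ _) hinj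
  simpa [ZMod.card] using this

/-- Lower bound for separated sets: a translate of `F⁻¹` contains at least `p |F|` free coordinates,
and points with all possible patterns there are separated. -/
theorem le_sepNum [∀ n, Nontrivial (G n)] {δ : ℝ}
    (hδ : ∀ x y : DualGroup G, coord x 1 ≠ coord y 1 → δ ≤ d x y) {p : ℝ}
    (hp : ∀ N, p ≤ density G N) (F : Finset (DirectSumGroup G)) :
    ∃ k : ℕ, p * F.card ≤ k ∧ ((2 ^ k : ℕ) : ℕ∞) ≤ sepNum d (constructionAction G) F δ := by
  classical
  obtain ⟨N, hN⟩ := exists_subset_head F⁻¹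
  obtain ⟨h, hh, hcard⟩ := exists_density_mul_card_le N F⁻¹
  set B := F⁻¹.filter fun a => h * a ∈ nontrivialBelow G N with hB
  have hx : ∀ S : Finset (DirectSumGroup G), ∃ x : DualGroup G,
      ∀ a ∈ B, coord x a = if a ∈ S then 1 else 0 := fun S => by
    obtain ⟨z, hz, hzS⟩ := exists_lineSumsVanish_eq N (S.image (h * ·))
    obtain ⟨x, rfl⟩ := exists_coord_eq hz
    refine ⟨constructionAction G h⁻¹ x, fun a ha => ?_⟩
    obtain ⟨ha, ha'⟩ := Finset.mem_filter.1 ha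
    rw [coord_constructionAction, inv_inv, hzS _ (mul_mem_head hh (hN ha)) ha']
    exact if_congr (by simp) rfl rfl
  choose x hx using hx
  have hne : ∀ S ∈ B.powerset, ∀ T ∈ B.powerset, S ≠ T →
      ∃ a ∈ B, coord (x S) a ≠ coord (x T) a := by
    intro S hS T hT hST
    by_contra! heq
    refine hST (Finset.ext fun a => ?_)
    by_cases ha : a ∈ B
    · have := heq a ha
      rw [hx S a ha, hx T a ha] at this
      by_cases h1 : a ∈ S <;> by_cases h2 : a ∈ T <;> simp_all
    · exact ⟨fun h => absurd (Finset.mem_powerset.1 hS h) ha,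
        fun h => absurd (Finset.mem_powerset.1 hT h) ha⟩
  refine ⟨B.card, ?_, ?_⟩
  · rw [Finset.card_inv] at hcard
    exact (mul_le_mul_of_nonneg_right (hp N) (Nat.cast_nonneg _)).trans hcard
  · have hinj : Set.InjOn x (B.powerset : Set _) := fun S hS T hT hST => by
      by_contra hne'
      obtain ⟨a, -, ha⟩ := hne S hS T hT hne'
      exact ha (by rw [hST])
    rw [← Finset.card_powerset, ← Finset.card_image_of_injOn hinj]
    refine card_le_sepNum fun u hu v hv huv => ?_
    obtain ⟨S, hS, rfl⟩ := Finset.mem_image.1 (Finset.mem_coe.1 hu)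
    obtain ⟨T, hT, rfl⟩ := Finset.mem_image.1 (Finset.mem_coe.1 hv)
    obtain ⟨a, ha, hne⟩ := hne S hS T hT fun h => huv (by rw [h])
    refine ⟨a⁻¹, Finset.mem_inv'.1 (Finset.mem_filter.1 ha).1, hδ _ _ ?_⟩
    rwa [coord_constructionAction, coord_constructionAction, inv_inv, mul_one]

theorem one_sub_inv_card_mem (n : ℕ) : 1 - (Fintype.card (G n) : ℝ)⁻¹ ∈ Set.Icc (0 : ℝ) 1 := by
  have h : (1 : ℝ) ≤ Fintype.card (G n) := by exact_mod_cast (Fintype.card_pos (α := G n))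
  have := inv_le_one_of_one_le₀ h
  have : (0 : ℝ) ≤ (Fintype.card (G n) : ℝ)⁻¹ := by positivity
  constructor <;> linarith

/-- A product of numbers in `[0, 1]` converges unconditionally. -/
theorem exists_hasProd_of_mem_Icc {f : ℕ → ℝ} (hf : ∀ n, f n ∈ Set.Icc (0 : ℝ) 1) :
    ∃ p, HasProd f p := by
  have hanti : Antitone fun s : Finset ℕ => ∏ n ∈ s, f n := fun s t hst => by
    change ∏ n ∈ t, f n ≤ ∏ n ∈ s, f n
    rw [← Finset.prod_sdiff hst]
    exact mul_le_of_le_one_left (Finset.prod_nonneg fun n _ => (hf n).1)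
      (Finset.prod_le_one (fun n _ => (hf n).1) fun n _ => (hf n).2)
  refine ⟨_, tendsto_atTop_ciInf hanti ⟨0, ?_⟩⟩
  rintro _ ⟨s, rfl⟩
  exact Finset.prod_nonneg fun n _ => (hf n).1

theorem density_antitone : Antitone (density G) :=
  antitone_nat_of_succ_le fun n => by
    rw [density, density, Finset.prod_range_succ]
    exact mul_le_of_le_one_right (Finset.prod_nonneg fun n _ => (one_sub_inv_card_mem n).1)
      (one_sub_inv_card_mem n).2

theorem topEntropyAlong_le (hd : IsCompatibleMetric d) {p : ℝ}
    (hp : Tendsto (density G) atTop (𝓝 p)) {F : ℕ → Finset (DirectSumGroup G)}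
    (hF : IsLeftFolner F) :
    topEntropyAlong d (constructionAction G) F ≤ ((p * Real.log 2 : ℝ) : EReal) := by
  classical
  refine iSup₂_le fun δ hδ => ?_
  obtain ⟨N₀, hN₀⟩ := sepNum_le hd hδ
  have hlim : Tendsto (fun N => ((density G N * Real.log 2 : ℝ) : EReal)) atTop
      (𝓝 ((p * Real.log 2 : ℝ) : EReal)) :=
    (continuous_coe_real_ereal.tendsto _).comp (hp.mul_const _)
  -- It suffices to bound the `limsup` for each large `N`, then let `N` tend to infinity.
  refine ge_of_tendsto hlim ((eventually_ge_atTop N₀).mono fun N hN => ?_)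
  obtain ⟨r, hr, hle⟩ := hF.exists_card_mul_le (head G N)
  have hr' : Tendsto (fun n => ((r n * (density G N * Real.log 2) : ℝ) : EReal)) atTop
      (𝓝 ((1 * (density G N * Real.log 2) : ℝ) : EReal)) :=
    (continuous_coe_real_ereal.tendsto _).comp (hr.mul_const _)
  rw [one_mul] at hr'
  rw [← hr'.limsup_eq]
  refine limsup_le_limsup ?_
  filter_upwards [hle, (isLeftFolner_iff.1 hF).1] with n hn hne
  obtain ⟨k, hk, hsep⟩ := hN₀ N hN (F n)
  have hpos : (0 : ℝ) < (F n).card := Nat.cast_pos.2 hne.card_pos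
  have hlog : ENNReal.log (sepNum d (constructionAction G) (F n) δ : ℝ≥0∞) ≤
      ((k * Real.log 2 : ℝ) : EReal) := by
    rw [← ennrealLog_two_pow]
    exact ENNReal.log_monotone (ENat.toENNReal_le.2 hsep)
  refine (EReal.div_le_div_right_of_nonneg (by positivity) hlog).trans ?_
  rw [← EReal.coe_natCast, ← EReal.coe_div, EReal.coe_le_coe_iff, div_le_iff₀ hpos, hk]
  have h2 : 0 ≤ density G N * Real.log 2 :=
    mul_nonneg (Finset.prod_nonneg fun n _ => (one_sub_inv_card_mem n).1)
      (Real.log_nonneg one_le_two)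
  calc density G N * ((head G N * F n).card : ℝ) * Real.log 2
      = (density G N * Real.log 2) * (head G N * F n).card := by ring
    _ ≤ (density G N * Real.log 2) * (r n * (F n).card) := mul_le_mul_of_nonneg_left hn h2
    _ = r n * (density G N * Real.log 2) * (F n).card := by ring

theorem le_topEntropyAlong [∀ n, Nontrivial (G n)] (hd : IsCompatibleMetric d) {p : ℝ}
    (hp : ∀ N, p ≤ density G N) {F : ℕ → Finset (DirectSumGroup G)} (hF : IsLeftFolner F) :
    ((p * Real.log 2 : ℝ) : EReal) ≤ topEntropyAlong d (constructionAction G) F := by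
  classical
  obtain ⟨δ, hδ, h⟩ := exists_pos_le_of_coord_ne hd
  refine le_iSup₂_of_le δ hδ (le_limsup_of_frequently_le (Eventually.frequently ?_))
  filter_upwards [(isLeftFolner_iff.1 hF).1] with n hne
  obtain ⟨k, hk, hsep⟩ := le_sepNum h hp (F n)
  have hpos : (0 : ℝ) < (F n).card := Nat.cast_pos.2 hne.card_pos
  have hlog : ((k * Real.log 2 : ℝ) : EReal) ≤
      ENNReal.log (sepNum d (constructionAction G) (F n) δ : ℝ≥0∞) := by
    rw [← ennrealLog_two_pow]
    exact ENNReal.log_monotone (ENat.toENNReal_le.2 hsep)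
  refine le_trans ?_ (EReal.div_le_div_right_of_nonneg (by positivity) hlog)
  rw [← EReal.coe_natCast, ← EReal.coe_div, EReal.coe_le_coe_iff, le_div_iff₀ hpos, mul_right_comm]
  exact mul_le_mul_of_nonneg_right hk (Real.log_nonneg one_le_two)

theorem topEntropyAlong_nonneg (F : ℕ → Finset (DirectSumGroup G)) :
    0 ≤ topEntropyAlong d (constructionAction G) F := by
  refine le_iSup₂_of_le 1 one_pos
    (le_limsup_of_frequently_le (Eventually.frequently (.of_forall fun n => ?_)))
  refine EReal.div_nonneg (ENNReal.zero_le_log_iff.2 ?_) (by positivity)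
  exact_mod_cast one_le_sepNum (F n) 1

theorem hasTopEntropy_constructionAction (hd : IsCompatibleMetric d) {p : ℝ}
    (hp : HasProd (fun n => 1 - (Fintype.card (G n) : ℝ)⁻¹) p) :
    HasTopEntropy d (constructionAction G) ((p * Real.log 2 : ℝ) : EReal) := by
  have hlim : Tendsto (density G) atTop (𝓝 p) := hp.tendsto_prod_nat
  intro F hF
  refine le_antisymm (topEntropyAlong_le hd hlim hF) ?_
  by_cases h : ∀ n, Nontrivial (G n)
  · exact le_topEntropyAlong hd (density_antitone.le_of_tendsto hlim) hF
  · -- If some `Γₙ` is trivial then the product has a factor `0`.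
    obtain ⟨n, hn⟩ := not_forall.1 h
    rw [not_nontrivial_iff_subsingleton] at hn
    have h0 : p = 0 := hp.unique (hasProd_zero_of_exists_eq_zero ⟨n, by
      rw [Fintype.card_eq_one_iff_nonempty_unique.2 ⟨⟨⟨1⟩, fun a => Subsingleton.elim _ _⟩⟩]
      simp⟩)
    rw [h0, zero_mul]
    exact topEntropyAlong_nonneg F

end AlgebraicAction

namespace AlgebraicAction

/-! ### Amenability, topology of the dual, and faithfulness -/

section

variable {G : ℕ → Type u} [∀ n, Group (G n)] [∀ n, Fintype (G n)]

theorem countable_directSumGroup : Countable (DirectSumGroup G) := by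
  refine Function.Surjective.countable
    (f := fun p : Σ N, {g : DirectSumGroup G // g ∈ head G N} => p.2.1) fun g => ?_
  obtain ⟨N, hN⟩ := g.2
  exact ⟨⟨N, g, mem_head.2 hN⟩, rfl⟩

/-- The finite subgroups `∏_{n < N} Γₙ` form a Følner sequence. -/
theorem isLeftFolner_head : IsLeftFolner (head G) := by
  classical
  refine isLeftFolner_iff.2 ⟨.of_forall fun N => ⟨1, one_mem_head N⟩, fun g => ?_⟩
  obtain ⟨K, hK⟩ := g.2
  refine tendsto_const_nhds.congr' ((eventually_ge_atTop K).mono fun N hN => ?_)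
  have hg : g ∈ head G N := mem_head.2 fun n hn => hK n (hN.trans hn)
  have : g • head G N = head G N := by
    ext x
    rw [← Finset.inv_smul_mem_iff, smul_eq_mul]
    refine ⟨fun h => ?_, mul_mem_head (inv_mem_head hg)⟩
    simpa using mul_mem_head hg h
  beta_reduce
  rw [this, symmDiff_self]
  simp

theorem metrizableSpace_dualGroup : TopologicalSpace.MetrizableSpace (DualGroup G) := by
  have := countable_directSumGroup (G := G)
  exact (isClosedEmbedding_coord (G := G)).isEmbedding.metrizableSpace

theorem totallyDisconnectedSpace_dualGroup : TotallyDisconnectedSpace (DualGroup G) :=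
  ⟨isClosedEmbedding_coord.isEmbedding.isTotallyDisconnected
    (isTotallyDisconnected_of_totallyDisconnectedSpace _)⟩

/-- The action is faithful once every block has at least three elements. -/
theorem constructionAction_injective (h3 : ∀ n, 2 < Fintype.card (G n)) :
    Function.Injective (constructionAction G) := by
  classical
  rw [injective_iff_map_eq_one]
  intro g hg
  have hb : ∀ n, ∃ b : G n, b ≠ 1 ∧ b ≠ (g.1 n)⁻¹ := fun n => by
    obtain ⟨b, -, hb⟩ := Finset.exists_mem_notMem_of_card_lt_card
      ((Finset.card_le_two (a := (1 : G n)) (b := (g.1 n)⁻¹)).trans_lt (h3 n))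
    exact ⟨b, by simpa using hb⟩
  choose b hb1 hbg using hb
  obtain ⟨x, hx⟩ := exists_coord_eq (lineSumsVanish_cubeIndicator hb1)
  have h1 : coord x 1 = 1 := by
    rw [hx]
    exact if_pos fun n => .inl rfl
  have h2 : coord x g⁻¹ = 1 := by
    rw [← h1, ← mul_one g⁻¹, ← coord_constructionAction, hg]
    rfl
  rw [hx] at h2
  have h3 : ∀ n, g⁻¹.1 n = 1 ∨ g⁻¹.1 n = b n := by
    by_contra h
    exact zero_ne_one ((if_neg h).symm.trans h2)
  exact inv_eq_one.1 (Subtype.ext (funext fun n => (h3 n).resolve_right (hbg n).symm))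

end

/-! ### Countable groups of exponent two and the abelian example -/

theorem rank_zmod_two_eq_aleph0 (V : Type*) [AddCommGroup V] [Module (ZMod 2) V] [Countable V]
    [Infinite V] : Module.rank (ZMod 2) V = Cardinal.aleph0 := by
  refine le_antisymm ((rank_le_card _ _).trans (Cardinal.mk_le_aleph0)) (not_lt.1 fun h => ?_)
  have := Module.rank_lt_aleph0_iff.1 h
  exact not_finite_iff_infinite.2 ‹Infinite V› (Module.finite_of_finite (ZMod 2))

theorem mul_comm_of_mul_self {A : Type*} [Group A] (h : ∀ a : A, a * a = 1) (a b : A) :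
    a * b = b * a := by
  have hinv := fun c => eq_inv_of_mul_eq_one_left (h c)
  rw [hinv (a * b), mul_inv_rev, ← hinv a, ← hinv b]

/-- Any two countably infinite groups of exponent two are isomorphic, being vector spaces over
`𝔽₂` of the same dimension. -/
theorem nonempty_mulEquiv_of_mul_self {A B : Type*} [Group A] [Group B] [Countable A] [Infinite A]
    [Countable B] [Infinite B] (hA : ∀ a : A, a * a = 1) (hB : ∀ b : B, b * b = 1) :
    Nonempty (A ≃* B) := by
  let _ : CommGroup A := { ‹Group A› with mul_comm := mul_comm_of_mul_self hA }
  let _ : CommGroup B := { ‹Group B› with mul_comm := mul_comm_of_mul_self hB }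
  let _ : Module (ZMod 2) (Additive A) :=
    AddCommGroup.zmodModule fun a => (two_nsmul a).trans (hA a.toMul)
  let _ : Module (ZMod 2) (Additive B) :=
    AddCommGroup.zmodModule fun b => (two_nsmul b).trans (hB b.toMul)
  have : Countable (Additive A) := ‹Countable A›
  have : Countable (Additive B) := ‹Countable B›
  obtain ⟨e⟩ := nonempty_linearEquiv_of_lift_rank_eq (R := ZMod 2) (M := Additive A)
    (M' := Additive B) (by rw [rank_zmod_two_eq_aleph0, rank_zmod_two_eq_aleph0]; simp)
  exact ⟨AddEquiv.toMultiplicative e.toAddEquiv⟩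

/-- The elementary abelian `2`-group of rank `n + 2`, so that `∏ₙ (1 - |Γₙ|⁻¹) > 0`. -/
abbrev BinaryBlock (n : ℕ) : Type := Multiplicative (Fin (n + 2) → ZMod 2)

theorem card_binaryBlock (n : ℕ) : Fintype.card (BinaryBlock n) = 2 ^ (n + 2) := by
  simp [BinaryBlock, ZMod.card]

/-- The error term `2 ^ (-(N + 1))` makes the lower bound `1 / 2` provable by induction. -/
theorem half_le_density_binaryBlock (N : ℕ) :
    1 / 2 + (1 / 2 : ℝ) ^ (N + 1) ≤ density BinaryBlock N := by
  induction N with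
  | zero => norm_num [density]
  | succ N ih =>
    have h1 : density BinaryBlock N ≤ 1 :=
      Finset.prod_le_one (fun n _ => (one_sub_inv_card_mem n).1)
        fun n _ => (one_sub_inv_card_mem n).2
    have h2 : density BinaryBlock (N + 1) = density BinaryBlock N * (1 - (1 / 2) ^ (N + 2)) := by
      rw [density, Finset.prod_range_succ, card_binaryBlock, density]
      simp
    have h3 : (0 : ℝ) < (1 / 2) ^ (N + 2) := by positivity
    rw [h2]
    have h4 : (1 / 2 : ℝ) ^ (N + 1) = 2 * (1 / 2) ^ (N + 2) := by ring
    rw [show N + 1 + 1 = N + 2 from rfl]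
    nlinarith

theorem binaryBlock_mul_self (g : DirectSumGroup BinaryBlock) : g * g = 1 :=
  Subtype.ext (funext fun n => congrArg Multiplicative.ofAdd
    (funext fun i => CharTwo.add_self_eq_zero ((g.1 n).toAdd i)))

theorem infinite_directSumGroup_binaryBlock : Infinite (DirectSumGroup BinaryBlock) := by
  have h : ∀ n, ∃ b : BinaryBlock n, b ≠ 1 := fun n => exists_ne 1
  choose b hb using h
  refine Infinite.of_injective (fun n => inclusion BinaryBlock n (b n)) fun m n hmn => ?_
  by_contra hne
  have := congrFun (congrArg Subtype.val hmn) m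
  simp only [inclusion_apply_self, inclusion_apply_of_ne hne] at this
  exact hb m this

theorem nonempty_binaryBlock_mulEquiv :
    Nonempty (DirectSumGroup BinaryBlock ≃* Multiplicative (DirectSum ℤ fun _ => ZMod 2)) := by
  classical
  have := countable_directSumGroup (G := BinaryBlock)
  have := infinite_directSumGroup_binaryBlock
  have : Countable (Multiplicative (DirectSum ℤ fun _ => ZMod 2)) :=
    inferInstanceAs (Countable (Π₀ _ : ℤ, ZMod 2))
  have : Infinite (Multiplicative (DirectSum ℤ fun _ => ZMod 2)) := by
    refine Infinite.of_injective
      (fun i : ℤ => Multiplicative.ofAdd (DirectSum.of (fun _ : ℤ => ZMod 2) i 1)) fun i j hij => ?_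
    by_contra hne
    have := DFunLike.congr_fun (Multiplicative.ofAdd.injective hij) i
    rw [DirectSum.of_eq_same, DirectSum.of_eq_of_ne _ _ _ hne] at this
    exact one_ne_zero this
  refine nonempty_mulEquiv_of_mul_self binaryBlock_mul_self fun b => ?_
  refine congrArg Multiplicative.ofAdd (DFunLike.ext _ _ fun i => ?_)
  exact CharTwo.add_self_eq_zero (b.toAdd i)

end AlgebraicAction

open AlgebraicAction in
theorem mainTheorem3 :
    (∃ (X : Type) (_ : CommGroup X) (_ : TopologicalSpace X) (_ : IsTopologicalGroup X)
        (Γ : Subgroup (X ≃ₜ* X)),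
      CompactSpace X ∧ T2Space X ∧ TopologicalSpace.MetrizableSpace X ∧
      TotallyDisconnectedSpace X ∧
      Countable Γ ∧ IsAmenable Γ ∧
      Nonempty (Γ ≃* Multiplicative (DirectSum ℤ fun _ => ZMod 2)) ∧
      (∃ h : EReal, 0 < h ∧
        ∀ d : X → X → ℝ, IsCompatibleMetric d →
          IsExpansive d Γ.subtype ∧
          HasTopEntropy d Γ.subtype h ∧
          (∀ x y : X, IsAsymptoticPair d Γ.subtype x y → x = y)) ∧
      (∃ (a : ℕ → ℕ) (e : X ≃ₜ* DualGroup fun n => Multiplicative (Fin (a n) → ZMod 2))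
          (φ : Γ ≃* DirectSumGroup fun n => Multiplicative (Fin (a n) → ZMod 2)),
        ∀ (γ : Γ) (x : X), e (γ.1 x) = constructionAction _ (φ γ) (e x))) ∧
    (∀ (G : ℕ → Type u) [∀ n, Group (G n)] [∀ n, Fintype (G n)],
      Countable (DirectSumGroup G) ∧ IsAmenable (DirectSumGroup G) ∧
      CompactSpace (DualGroup G) ∧ T2Space (DualGroup G) ∧
      TopologicalSpace.MetrizableSpace (DualGroup G) ∧
      TotallyDisconnectedSpace (DualGroup G) ∧
      ∃ p : ℝ, HasProd (fun n => 1 - (Fintype.card (G n) : ℝ)⁻¹) p ∧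
        ∀ d : DualGroup G → DualGroup G → ℝ, IsCompatibleMetric d →
          IsExpansive d (constructionAction G) ∧
          HasTopEntropy d (constructionAction G) ((p * Real.log 2 : ℝ) : EReal) ∧
          homoclinicGroup d (constructionAction G) = {1} ∧
          (∀ x y : DualGroup G, IsAsymptoticPair d (constructionAction G) x y → x = y)) := by
  constructor
  · have hinj : Function.Injective (constructionAction BinaryBlock) :=
      constructionAction_injective fun n => by
        rw [card_binaryBlock]
        calc 2 < 2 ^ 2 := by norm_num
          _ ≤ 2 ^ (n + 2) := Nat.pow_le_pow_right (by norm_num) (by omega)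
    obtain ⟨p, hp⟩ := exists_hasProd_of_mem_Icc (one_sub_inv_card_mem (G := BinaryBlock))
    have hp0 : 1 / 2 ≤ p := by
      refine ge_of_tendsto' (x := atTop) (f := density BinaryBlock) hp.tendsto_prod_nat fun N => ?_
      have : (0 : ℝ) < (1 / 2) ^ (N + 1) := by positivity
      linarith [half_le_density_binaryBlock N]
    let φ : DirectSumGroup BinaryBlock ≃* (constructionAction BinaryBlock).range :=
      MonoidHom.ofInjective hinj
    have hφ : (constructionAction BinaryBlock).range.subtype =
        (constructionAction BinaryBlock).comp φ.symm.toMonoidHom := by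
      ext1 γ
      obtain ⟨g, rfl⟩ := φ.surjective γ
      exact congrArg (constructionAction BinaryBlock) (φ.symm_apply_apply g).symm
    refine ⟨DualGroup BinaryBlock, inferInstance, inferInstance, inferInstance,
      (constructionAction BinaryBlock).range, inferInstance, inferInstance,
      metrizableSpace_dualGroup, totallyDisconnectedSpace_dualGroup, ?_,
      ⟨_, isLeftFolner_head.map φ⟩, ?_, ⟨((p * Real.log 2 : ℝ) : EReal), ?_, fun d hd => ?_⟩, ?_⟩
    · have := countable_directSumGroup (G := BinaryBlock)
      exact φ.surjective.countable
    · obtain ⟨e⟩ := nonempty_binaryBlock_mulEquiv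
      exact ⟨φ.symm.trans e⟩
    · exact EReal.coe_pos.2 (mul_pos (by linarith) (Real.log_pos one_lt_two))
    · rw [hφ]
      refine ⟨?_, (hasTopEntropy_constructionAction hd hp).comp φ.symm, fun x y hxy => ?_⟩
      · obtain ⟨c, hc, h⟩ := isExpansive_constructionAction hd
        refine ⟨c, hc, fun x y hxy => ?_⟩
        obtain ⟨g, hg⟩ := h x y hxy
        refine ⟨φ g, ?_⟩
        change c < d (constructionAction BinaryBlock (φ.symm (φ g)) x)
          (constructionAction BinaryBlock (φ.symm (φ g)) y)
        rwa [φ.symm_apply_apply]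
      · refine eq_of_isAsymptoticPair hd fun ε hε => ?_
        refine ((hxy ε hε).preimage φ.injective.injOn).subset fun g hg => ?_
        change ε < d (constructionAction BinaryBlock (φ.symm (φ g)) x)
          (constructionAction BinaryBlock (φ.symm (φ g)) y)
        rwa [φ.symm_apply_apply]
    · refine ⟨fun n => n + 2, ContinuousMulEquiv.refl _, φ.symm, fun γ x => ?_⟩
      exact congrArg (fun f => f x) (DFunLike.congr_fun hφ γ)
  · intro G _ _
    obtain ⟨p, hp⟩ := exists_hasProd_of_mem_Icc (one_sub_inv_card_mem (G := G))
    exact ⟨countable_directSumGroup, ⟨_, isLeftFolner_head⟩, inferInstance, inferInstance,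
      metrizableSpace_dualGroup, totallyDisconnectedSpace_dualGroup, p, hp, fun d hd =>
      ⟨isExpansive_constructionAction hd, hasTopEntropy_constructionAction hd hp,
        homoclinicGroup_eq hd, fun x y => eq_of_isAsymptoticPair hd⟩⟩
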